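/- **Proposition 3.2.** Let $n\ge 1$, let $X\in\mathbb{R}^{n\times d}$ be a fixed data matrix, and for $g\in\mathbb{R}^d$ let $D(g)=\mathrm{diag}(\mathbb{1}[Xg\ge 0])$ be the $n\times n$ diagonal matrix whose $i$-th diagonal entry is $1$ if $(Xg)_i\ge 0$ and $0$ otherwise. Let $$\mathcal{M}=\mathbb{E}_{g\sim\mathcal{N}(0,I_d)}\big[D(g)\,XX^{T}D(g)\big],$$ suppose that $\mathcal{M}$ is invertible, and put $\kappa=\lambda_{\max}(XX^{T})/\lambda_{\min}(\mathcal{M})$. Let $\delta>0$, let $\tilde P$ be a nonnegative integer with $\tilde P\ge 2\kappa\log(n/\delta)$, let $g_1,\dots,g_{\tilde P}\sim\mathcal{N}(0,I_d)$ be independent, and let $\tilde D_i=D(g_i)$. Then, with probability at least $1-\delta$, the following holds simultaneously for all $y\in\mathbb{R}^n$: there exist $u_1,\dots,u_{\tilde P}\in\mathbb{R}^d$ with $$\sum_{i=1}^{\tilde P}\tilde D_iXu_i=y ,$$ and, in particular, the unregularized ($\beta=0$) unconstrained relaxed problem has optimal value zero, attained: $$\min_{u_1,\dots,u_{\tilde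 P}\in\mathbb{R}^d}\ \frac12\Big\lVert\sum_{i=1}^{\tilde P}\tilde D_iXu_i-y\Big\rVert_2^2+\beta\sum_{i=1}^{\tilde P}\lVert u_i\rVert_2\;=\;0\qquad\text{for }\beta=0.$$ -/

import Mathlib

open MeasureTheory ProbabilityTheory

namespace GatedReLU

noncomputable section

/-- The hyperplane arrangement pattern `diag(𝟙[X g ≥ 0])` of the data matrix `X` given by the
vector `g`. -/
def pattern {n d : ℕ} (X : Matrix (Fin n) (Fin d) ℝ) (g : EuclideanSpace ℝ (Fin d)) :
    Matrix (Fin n) (Fin n) ℝ :=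
  Matrix.diagonal fun i => if 0 ≤ (X.mulVec g.ofLp) i then 1 else 0

/-- The matrix `𝔼 [D X Xᵀ D]`, where `D = diag(𝟙[X g ≥ 0])` and `g ∼ 𝒩(0, I_d)`. The expectation
is taken entrywise; each entry is a bounded measurable function of `g`. -/
def meanGram {n d : ℕ} (X : Matrix (Fin n) (Fin d) ℝ) : Matrix (Fin n) (Fin n) ℝ :=
  Matrix.of fun i j =>
    ∫ g, (pattern X g * (X * X.transpose) * pattern X g) i j
      ∂(stdGaussian (EuclideanSpace ℝ (Fin d)))

/-- The largest real eigenvalue; used for symmetric matrices of positive size. -/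
def eigMax {n : ℕ} (A : Matrix (Fin n) (Fin n) ℝ) : ℝ := sSup (spectrum ℝ A)

/-- The smallest real eigenvalue; used for symmetric matrices of positive size. -/
def eigMin {n : ℕ} (A : Matrix (Fin n) (Fin n) ℝ) : ℝ := sInf (spectrum ℝ A)

/-- The condition-number-like quantity `κ = λ_max(X Xᵀ) / λ_min(M)`, where `M = meanGram X`;
meaningful when `M` is invertible. -/
def kappa {n d : ℕ} (X : Matrix (Fin n) (Fin d) ℝ) : ℝ :=
  eigMax (X * X.transpose) / eigMin (meanGram X)

/-- The vector `∑ᵢ Dᵢ X uᵢ`. -/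
def output {n d P : ℕ} (X : Matrix (Fin n) (Fin d) ℝ) (D : Fin P → Matrix (Fin n) (Fin n) ℝ)
    (u : Fin P → EuclideanSpace ℝ (Fin d)) : EuclideanSpace ℝ (Fin n) :=
  WithLp.toLp 2 (∑ i, (D i * X).mulVec (u i).ofLp)

/-- The objective `½ ‖∑ᵢ Dᵢ X uᵢ - y‖₂² + β ∑ᵢ ‖uᵢ‖₂` of the unconstrained convex problem with the
patterns `D₁, …, D_P`, labels `y` and regularization parameter `β`. -/
def objective {n d P : ℕ} (X : Matrix (Fin n) (Fin d) ℝ)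
    (D : Fin P → Matrix (Fin n) (Fin n) ℝ) (y : EuclideanSpace ℝ (Fin n)) (β : ℝ)
    (u : Fin P → EuclideanSpace ℝ (Fin d)) : ℝ :=
  1 / 2 * ‖output X D u - y‖ ^ 2 + β * ∑ i, ‖u i‖

end

end GatedReLU

/-! The unconstrained problem is solvable for every `y` as soon as the maps `(Dᵢ X)ᵀ` have no common
kernel (`exists_output_eq`). The dimension of this common kernel is controlled in expectation,
instead of the smallest eigenvalue of `∑ Dᵢ X Xᵀ Dᵢ`, so no matrix concentration inequality is
needed.

Let `R = λ_max(X Xᵀ)` and `m = λ_min(𝔼[D X Xᵀ D])`. For a fixed subspace `W`, the trace of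
`D X Xᵀ D` compressed to `W` is at least `m dim W` in the mean, while for each `D` it is at most
`R` times its rank `dim W - dim (W ⊓ ker (D X)ᵀ)`. Hence intersecting `W` with a random kernel
multiplies its expected dimension by at most `1 - m / R = 1 - 1 / κ`
(`sum_mul_finrank_inf_ker_le`). After `P` independent draws, starting from the whole space, the
expected dimension is at most `n (1 - 1 / κ) ^ P ≤ n exp (-P / κ)`, and it bounds the probability
that the common kernel is nontrivial (`sum_prod_le_of_iInf_ker_ne_bot`). This is at most `δ` once
`P ≥ κ log (n / δ)`.

A pattern depends on `g` only through the sign vector of `X g`, which takes finitely many values,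
so all expectations are finite sums against `signLaw X`. -/

namespace GatedReLU

/-! ### Dimension loss under a random kernel -/

section Subspaces

variable {E F S : Type*} [NormedAddCommGroup E] [InnerProductSpace ℝ E] [FiniteDimensional ℝ E]
  [NormedAddCommGroup F] [InnerProductSpace ℝ F]

/-- The left side is the trace of the projection, computed in the basis `b` of the whole space. -/
theorem sum_norm_sq_starProjection_eq_finrank {ι : Type*} [Fintype ι]
    (b : OrthonormalBasis ι ℝ E) (K : Submodule ℝ E) :
    ∑ j, ‖K.starProjection (b j)‖ ^ 2 = Module.finrank ℝ K := by
  have h1 : ∀ j, ‖K.starProjection (b j)‖ ^ 2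
      = ∑ l, (inner ℝ ((stdOrthonormalBasis ℝ K l : K) : E) (b j)) ^ 2 := by
    intro j
    have h := (stdOrthonormalBasis ℝ K).sum_sq_norm_inner_right (K.orthogonalProjectionOnto (b j))
    rw [Submodule.starProjection_apply, Submodule.norm_coe, ← h]
    refine Finset.sum_congr rfl fun l _ => ?_
    rw [Real.norm_eq_abs, sq_abs, Submodule.inner_orthogonalProjectionOnto_eq_of_mem_left]
  simp_rw [h1]
  rw [Finset.sum_comm]
  have h2 : ∀ l, ∑ j, (inner ℝ ((stdOrthonormalBasis ℝ K l : K) : E) (b j)) ^ 2 = 1 := by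
    intro l
    have h := b.sum_sq_norm_inner_left ((stdOrthonormalBasis ℝ K l : K) : E)
    simp only [Real.norm_eq_abs, sq_abs] at h
    rw [h, Submodule.norm_coe, (stdOrthonormalBasis ℝ K).norm_eq_one, one_pow]
  simp [h2]

/-- The Hilbert–Schmidt norm is bounded by operator norm and rank: `T` factors through the
orthogonal projection onto `(ker T)ᗮ`, whose trace is the rank of `T`. -/
theorem sum_norm_sq_le_mul_sub_finrank_ker {ι : Type*} [Fintype ι] (b : OrthonormalBasis ι ℝ E)
    (T : E →ₗ[ℝ] F) {R : ℝ} (hT : ∀ x, ‖T x‖ ^ 2 ≤ R * ‖x‖ ^ 2) :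
    ∑ j, ‖T (b j)‖ ^ 2 ≤ R * (Module.finrank ℝ E - Module.finrank ℝ (LinearMap.ker T)) := by
  have hK : ∀ x, T x = T ((LinearMap.ker T)ᗮ.starProjection x) := by
    intro x
    have h := (LinearMap.ker T).starProjection_add_starProjection_orthogonal x
    have h0 : T ((LinearMap.ker T).starProjection x) = 0 :=
      ((LinearMap.ker T).orthogonalProjectionOnto x).2
    conv_lhs => rw [← h, map_add, h0, zero_add]
  have hd : (Module.finrank ℝ E : ℝ) - Module.finrank ℝ (LinearMap.ker T)
      = Module.finrank ℝ (LinearMap.ker T)ᗮ := by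
    rw [← (LinearMap.ker T).finrank_add_finrank_orthogonal]
    push_cast
    ring
  rw [hd, ← sum_norm_sq_starProjection_eq_finrank b, Finset.mul_sum]
  refine Finset.sum_le_sum fun j _ => ?_
  rw [hK]
  exact hT _

variable [Fintype S]

/-- Intersecting `W` with the kernel of a random map `B s` shrinks the expected dimension by the
factor `1 - m / R`, where `R` bounds every `(B s)ᵀ (B s)` and `m` bounds their mean from below. -/
theorem sum_mul_finrank_inf_ker_le (B : S → E →ₗ[ℝ] F) (p : S → ℝ) (hp : ∀ s, 0 ≤ p s)
    (hp1 : ∑ s, p s = 1) {R m : ℝ} (hR : 0 < R) (hB : ∀ s x, ‖B s x‖ ^ 2 ≤ R * ‖x‖ ^ 2)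
    (hm : ∀ x, m * ‖x‖ ^ 2 ≤ ∑ s, p s * ‖B s x‖ ^ 2) (W : Submodule ℝ E) :
    ∑ s, p s * (Module.finrank ℝ (W ⊓ LinearMap.ker (B s) : Submodule ℝ E) : ℝ)
      ≤ (1 - m / R) * Module.finrank ℝ W := by
  let b := stdOrthonormalBasis ℝ W
  have h1 : ∀ s, ∑ j, ‖B s (b j)‖ ^ 2 ≤ R * (Module.finrank ℝ W -
      Module.finrank ℝ (W ⊓ LinearMap.ker (B s) : Submodule ℝ E)) := by
    intro s
    have h := sum_norm_sq_le_mul_sub_finrank_ker b ((B s).domRestrict W) (R := R)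
      (fun x => hB s x)
    have hk : Module.finrank ℝ (LinearMap.ker ((B s).domRestrict W))
        = Module.finrank ℝ (W ⊓ LinearMap.ker (B s) : Submodule ℝ E) := by
      rw [LinearMap.ker_domRestrict, ← Submodule.map_comap_subtype]
      exact (Submodule.finrank_map_subtype_eq W _).symm
    rwa [hk] at h
  have h2 : m * Module.finrank ℝ W ≤ ∑ s, p s * ∑ j, ‖B s (b j)‖ ^ 2 := by
    simp_rw [Finset.mul_sum]
    rw [Finset.sum_comm]
    calc m * Module.finrank ℝ W = ∑ j, m * ‖((b j : W) : E)‖ ^ 2 := by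
          simp [Submodule.norm_coe, mul_comm]
      _ ≤ _ := Finset.sum_le_sum fun j _ => hm _
  have h3 : ∑ s, p s * ∑ j, ‖B s (b j)‖ ^ 2 ≤ ∑ s, p s * (R * (Module.finrank ℝ W -
      Module.finrank ℝ (W ⊓ LinearMap.ker (B s) : Submodule ℝ E))) :=
    Finset.sum_le_sum fun s _ => mul_le_mul_of_nonneg_left (h1 s) (hp s)
  have h4 : ∑ s, p s * (R * ((Module.finrank ℝ W : ℝ) -
      Module.finrank ℝ (W ⊓ LinearMap.ker (B s) : Submodule ℝ E)))
      = R * (Module.finrank ℝ W -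
        ∑ s, p s * (Module.finrank ℝ (W ⊓ LinearMap.ker (B s) : Submodule ℝ E) : ℝ)) := by
    have hW : (Module.finrank ℝ W : ℝ) = ∑ s, p s * (Module.finrank ℝ W : ℝ) := by
      rw [← Finset.sum_mul, hp1, one_mul]
    conv_rhs => rw [hW, ← Finset.sum_sub_distrib, Finset.mul_sum]
    exact Finset.sum_congr rfl fun s _ => by ring
  have h5 := h2.trans (h3.trans_eq h4)
  have h6 : m / R * Module.finrank ℝ W ≤ Module.finrank ℝ W -
        ∑ s, p s * (Module.finrank ℝ (W ⊓ LinearMap.ker (B s) : Submodule ℝ E) : ℝ) := by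
    rw [div_mul_eq_mul_div, div_le_iff₀ hR]
    linarith
  linarith

/-- Independent draws: conditioning on the first one replaces `W` by `W ⊓ ker (B s)`, so the
one-step estimate can be iterated. -/
theorem sum_prod_mul_finrank_inf_iInf_ker_le (B : S → E →ₗ[ℝ] F) (p : S → ℝ) (hp : ∀ s, 0 ≤ p s)
    (hp1 : ∑ s, p s = 1) {R m : ℝ} (hR : 0 < R) (hmR : m ≤ R)
    (hB : ∀ s x, ‖B s x‖ ^ 2 ≤ R * ‖x‖ ^ 2)
    (hm : ∀ x, m * ‖x‖ ^ 2 ≤ ∑ s, p s * ‖B s x‖ ^ 2) (k : ℕ) (W : Submodule ℝ E) :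
    ∑ t : Fin k → S, (∏ i, p (t i)) *
        (Module.finrank ℝ (W ⊓ ⨅ i, LinearMap.ker (B (t i)) : Submodule ℝ E) : ℝ)
      ≤ (1 - m / R) ^ k * Module.finrank ℝ W := by
  induction k generalizing W with
  | zero => simpa using Submodule.finrank_mono inf_le_left
  | succ k ih =>
    have hc : 0 ≤ 1 - m / R := sub_nonneg.2 ((div_le_one hR).2 hmR)
    rw [← (Fin.consEquiv fun _ => S).sum_comp, Fintype.sum_prod_type]
    have hcons : ∀ (s : S) (t : Fin k → S),
        (⨅ i, LinearMap.ker (B ((Fin.cons s t : Fin (k + 1) → S) i)))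
          = LinearMap.ker (B s) ⊓ ⨅ i, LinearMap.ker (B (t i)) := by
      intro s t
      apply le_antisymm
      · refine le_inf ?_ (le_iInf fun i => ?_)
        · exact (iInf_le _ 0).trans (by simp)
        · exact (iInf_le _ i.succ).trans (by simp)
      · refine le_iInf fun i => ?_
        refine Fin.cases ?_ (fun i => ?_) i
        · exact inf_le_left.trans (by simp)
        · exact inf_le_right.trans ((iInf_le _ i).trans (by simp))
    calc _ = ∑ s, p s * ∑ t : Fin k → S, (∏ i, p (t i)) *
          (Module.finrank ℝ ((W ⊓ LinearMap.ker (B s)) ⊓ ⨅ i, LinearMap.ker (B (t i)) :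
            Submodule ℝ E) : ℝ) := by
          refine Finset.sum_congr rfl fun s _ => ?_
          rw [Finset.mul_sum]
          refine Finset.sum_congr rfl fun t _ => ?_
          change (∏ i, p ((Fin.cons s t : Fin (k + 1) → S) i)) * (Module.finrank ℝ
            (W ⊓ ⨅ i, LinearMap.ker (B ((Fin.cons s t : Fin (k + 1) → S) i)) :
              Submodule ℝ E) : ℝ) = _
          rw [hcons, Fin.prod_univ_succ, inf_assoc]
          simp [mul_assoc]
      _ ≤ ∑ s, p s * ((1 - m / R) ^ k *
          Module.finrank ℝ (W ⊓ LinearMap.ker (B s) : Submodule ℝ E)) :=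
          Finset.sum_le_sum fun s _ => mul_le_mul_of_nonneg_left (ih _) (hp s)
      _ = (1 - m / R) ^ k *
          ∑ s, p s * (Module.finrank ℝ (W ⊓ LinearMap.ker (B s) : Submodule ℝ E) : ℝ) := by
          rw [Finset.mul_sum]
          exact Finset.sum_congr rfl fun s _ => by ring
      _ ≤ (1 - m / R) ^ k * ((1 - m / R) * Module.finrank ℝ W) :=
          mul_le_mul_of_nonneg_left (sum_mul_finrank_inf_ker_le B p hp hp1 hR hB hm W)
            (pow_nonneg hc k)
      _ = _ := by ring

/-- A nontrivial common kernel has dimension at least one, so its probability is at most its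
expected dimension. -/
theorem sum_prod_le_of_iInf_ker_ne_bot (B : S → E →ₗ[ℝ] F) (p : S → ℝ) (hp : ∀ s, 0 ≤ p s)
    (hp1 : ∑ s, p s = 1) {R m : ℝ} (hR : 0 < R) (hmR : m ≤ R)
    (hB : ∀ s x, ‖B s x‖ ^ 2 ≤ R * ‖x‖ ^ 2)
    (hm : ∀ x, m * ‖x‖ ^ 2 ≤ ∑ s, p s * ‖B s x‖ ^ 2) (k : ℕ) (G : Finset (Fin k → S))
    (hG : ∀ t ∈ G, (⨅ i, LinearMap.ker (B (t i))) ≠ ⊥) :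
    ∑ t ∈ G, ∏ i, p (t i) ≤ Module.finrank ℝ E * Real.exp (-(k * (m / R))) := by
  have h := sum_prod_mul_finrank_inf_iInf_ker_le B p hp hp1 hR hmR hB hm k ⊤
  have hprod : ∀ t : Fin k → S, 0 ≤ ∏ i, p (t i) := fun t => Finset.prod_nonneg fun i _ => hp _
  calc ∑ t ∈ G, ∏ i, p (t i)
      ≤ ∑ t ∈ G, (∏ i, p (t i)) *
        (Module.finrank ℝ (⊤ ⊓ ⨅ i, LinearMap.ker (B (t i)) : Submodule ℝ E) : ℝ) := by
        refine Finset.sum_le_sum fun t ht => le_mul_of_one_le_right (hprod t) ?_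
        rw [top_inf_eq]
        exact_mod_cast Submodule.one_le_finrank_iff.2 (hG t ht)
    _ ≤ _ := Finset.sum_le_univ_sum_of_nonneg fun t => mul_nonneg (hprod t) (Nat.cast_nonneg _)
    _ ≤ _ := h
    _ ≤ _ := by
        rw [finrank_top, mul_comm]
        refine mul_le_mul_of_nonneg_left ?_ (Nat.cast_nonneg _)
        rw [← mul_neg, Real.exp_nat_mul]
        exact pow_le_pow_left₀ (sub_nonneg.2 ((div_le_one hR).2 hmR))
          (Real.one_sub_le_exp_neg _) k

end Subspaces

/-! ### Extreme eigenvalues and quadratic forms -/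

section Eigenvalues

variable {n : ℕ} {A : Matrix (Fin n) (Fin n) ℝ}

theorem mul_dotProduct_le_of_le_spectrum (hA : A.IsHermitian) {c : ℝ}
    (hc : ∀ t ∈ spectrum ℝ A, c ≤ t) (x : Fin n → ℝ) :
    c * (x ⬝ᵥ x) ≤ x ⬝ᵥ A.mulVec x := by
  have hH : (A - algebraMap ℝ _ c).IsHermitian := by
    refine hA.sub ?_
    rw [Algebra.algebraMap_eq_smul_one]
    simp [Matrix.IsHermitian]
  have hpsd : (A - algebraMap ℝ _ c).PosSemidef := by
    refine hH.posSemidef_iff_eigenvalues_nonneg.2 fun i => ?_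
    have h := hH.eigenvalues_mem_spectrum_real i
    rw [← spectrum.sub_singleton_eq] at h
    obtain ⟨t, ht, u, hu, htu⟩ := h
    rw [Set.mem_singleton_iff] at hu
    have := hc t ht
    simp only [Pi.zero_apply]
    simp only at htu
    linarith
  have h := hpsd.dotProduct_mulVec_nonneg x
  rw [Algebra.algebraMap_eq_smul_one, Matrix.sub_mulVec, Matrix.smul_mulVec, Matrix.one_mulVec,
    dotProduct_sub, dotProduct_smul, star_trivial, smul_eq_mul] at h
  linarith

theorem finite_spectrum_of_isHermitian (hA : A.IsHermitian) : (spectrum ℝ A).Finite := by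
  rw [hA.spectrum_real_eq_range_eigenvalues]
  exact Set.finite_range _

theorem eigMin_mul_dotProduct_le (hA : A.IsHermitian) (x : Fin n → ℝ) :
    eigMin A * (x ⬝ᵥ x) ≤ x ⬝ᵥ A.mulVec x :=
  mul_dotProduct_le_of_le_spectrum hA
    (fun _ ht => csInf_le (finite_spectrum_of_isHermitian hA).bddBelow ht) x

theorem dotProduct_mulVec_le_eigMax_mul (hA : A.IsHermitian) (x : Fin n → ℝ) :
    x ⬝ᵥ A.mulVec x ≤ eigMax A * (x ⬝ᵥ x) := by
  have h := mul_dotProduct_le_of_le_spectrum hA.neg (c := -eigMax A) (fun t ht => by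
    rw [← spectrum.neg_eq, Set.mem_neg] at ht
    have := le_csSup (finite_spectrum_of_isHermitian hA).bddAbove ht
    rw [eigMax]
    linarith) x
  rw [Matrix.neg_mulVec, dotProduct_neg] at h
  linarith

theorem eigMin_pos (hn : 0 < n) (hA : A.PosSemidef) (hu : IsUnit A) : 0 < eigMin A := by
  have hmem : eigMin A ∈ spectrum ℝ A := by
    refine Set.Nonempty.csInf_mem ?_ (finite_spectrum_of_isHermitian hA.1)
    exact ⟨_, hA.1.eigenvalues_mem_spectrum_real ⟨0, hn⟩⟩
  have h0 : 0 ≤ eigMin A := by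
    have h := hmem
    rw [hA.1.spectrum_real_eq_range_eigenvalues] at h
    obtain ⟨i, hi⟩ := h
    exact hi ▸ hA.eigenvalues_nonneg i
  refine lt_of_le_of_ne h0 fun h => ?_
  rw [← h] at hmem
  exact (spectrum.zero_notMem_iff ℝ).2 hu hmem

end Eigenvalues

/-! ### The finitely many sign patterns -/

section Patterns

variable {n d : ℕ}

/-- The sign vector of `X g`: the finite-valued random variable through which `pattern X g`
depends on `g`. -/
noncomputable def signs (X : Matrix (Fin n) (Fin d) ℝ) (g : EuclideanSpace ℝ (Fin d)) :
    Fin n → Bool :=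
  fun i => decide (0 ≤ (X.mulVec g.ofLp) i)

/-- The diagonal `0`-`1` matrix selecting the coordinates where `s` is true. -/
def mask (s : Fin n → Bool) : Matrix (Fin n) (Fin n) ℝ :=
  Matrix.diagonal fun i => if s i then 1 else 0

/-- The linear map `(D X)ᵀ`, where `D` is the mask of `s`. -/
noncomputable def maskedTranspose (X : Matrix (Fin n) (Fin d) ℝ) (s : Fin n → Bool) :
    EuclideanSpace ℝ (Fin n) →ₗ[ℝ] EuclideanSpace ℝ (Fin d) :=
  Matrix.toEuclideanLin (mask s * X).transpose

theorem pattern_eq_mask_signs (X : Matrix (Fin n) (Fin d) ℝ) (g : EuclideanSpace ℝ (Fin d)) :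
    pattern X g = mask (signs X g) := by
  simp [pattern, mask, signs]

theorem mask_transpose (s : Fin n → Bool) : (mask s).transpose = mask s :=
  Matrix.diagonal_transpose _

theorem measurable_signs (X : Matrix (Fin n) (Fin d) ℝ) : Measurable (signs X) := by
  refine measurable_pi_lambda _ fun i => ?_
  refine measurable_to_bool ?_
  have h : (fun g : EuclideanSpace ℝ (Fin d) => signs X g i) ⁻¹' {true}
      = {g | 0 ≤ (X.mulVec g.ofLp) i} := by
    ext g
    simp [signs]
  rw [h]
  refine measurableSet_le measurable_const ?_
  simp only [Matrix.mulVec, dotProduct]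
  fun_prop

theorem norm_sq_eq_dotProduct {m : ℕ} (x : EuclideanSpace ℝ (Fin m)) :
    ‖x‖ ^ 2 = x.ofLp ⬝ᵥ x.ofLp := by
  rw [EuclideanSpace.real_norm_sq_eq]
  simp [dotProduct, sq]

theorem norm_sq_maskedTranspose (X : Matrix (Fin n) (Fin d) ℝ) (s : Fin n → Bool)
    (x : EuclideanSpace ℝ (Fin n)) :
    ‖maskedTranspose X s x‖ ^ 2
      = x.ofLp ⬝ᵥ (mask s * (X * X.transpose) * mask s).mulVec x.ofLp := by
  rw [norm_sq_eq_dotProduct, maskedTranspose, Matrix.ofLp_toLpLin, Matrix.toLin'_apply,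
    Matrix.dotProduct_mulVec, Matrix.vecMul_transpose, Matrix.mulVec_mulVec, dotProduct_comm,
    Matrix.transpose_mul, mask_transpose]
  simp only [Matrix.mul_assoc]

theorem eigMax_nonneg (X : Matrix (Fin n) (Fin d) ℝ) : 0 ≤ eigMax (X * X.transpose) := by
  have hpsd : (X * X.transpose).PosSemidef := by
    simpa [Matrix.conjTranspose_eq_transpose_of_trivial] using
      Matrix.posSemidef_self_mul_conjTranspose X
  refine Real.sSup_nonneg fun t ht => ?_
  rw [hpsd.1.spectrum_real_eq_range_eigenvalues] at ht
  obtain ⟨i, rfl⟩ := ht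
  exact hpsd.eigenvalues_nonneg i

/-- The mask does not increase norms, so the bound for `X Xᵀ` passes to `D X Xᵀ D`. -/
theorem norm_sq_maskedTranspose_le (X : Matrix (Fin n) (Fin d) ℝ)
    (s : Fin n → Bool) (x : EuclideanSpace ℝ (Fin n)) :
    ‖maskedTranspose X s x‖ ^ 2 ≤ eigMax (X * X.transpose) * ‖x‖ ^ 2 := by
  have hH : (X * X.transpose).IsHermitian := by
    simp [Matrix.IsHermitian, Matrix.conjTranspose_eq_transpose_of_trivial]
  have h1 : x.ofLp ⬝ᵥ (mask s * (X * X.transpose) * mask s).mulVec x.ofLp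
      = (mask s).mulVec x.ofLp ⬝ᵥ (X * X.transpose).mulVec ((mask s).mulVec x.ofLp) := by
    rw [← Matrix.mulVec_mulVec, ← Matrix.mulVec_mulVec, Matrix.dotProduct_mulVec,
      ← Matrix.mulVec_transpose, mask_transpose]
  rw [norm_sq_maskedTranspose, h1, norm_sq_eq_dotProduct]
  refine (dotProduct_mulVec_le_eigMax_mul hH _).trans 
    (mul_le_mul_of_nonneg_left ?_ (eigMax_nonneg X))
  refine Finset.sum_le_sum fun i _ => ?_
  simp only [mask, Matrix.mulVec_diagonal]
  split_ifs
  · simp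
  · simpa using mul_self_nonneg (x.ofLp i)

/-- The law of the sign vector of `X g` for standard Gaussian `g`. -/
noncomputable def signLaw (X : Matrix (Fin n) (Fin d) ℝ) : Measure (Fin n → Bool) :=
  (stdGaussian (EuclideanSpace ℝ (Fin d))).map (signs X)

instance (X : Matrix (Fin n) (Fin d) ℝ) : IsProbabilityMeasure (signLaw X) :=
  Measure.isProbabilityMeasure_map (measurable_signs X).aemeasurable

theorem meanGram_eq_sum (X : Matrix (Fin n) (Fin d) ℝ) :
    meanGram X = ∑ s, (signLaw X).real {s} • (mask s * (X * X.transpose) * mask s) := by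
  ext i j
  rw [meanGram, Matrix.of_apply, Matrix.sum_apply]
  simp only [pattern_eq_mask_signs, Matrix.smul_apply]
  rw [← integral_map (φ := signs X) (measurable_signs X).aemeasurable
    (f := fun s => (mask s * (X * X.transpose) * mask s) i j)
    (measurable_of_finite _).aestronglyMeasurable]
  exact integral_fintype .of_finite

theorem dotProduct_meanGram_mulVec (X : Matrix (Fin n) (Fin d) ℝ)
    (x : EuclideanSpace ℝ (Fin n)) :
    x.ofLp ⬝ᵥ (meanGram X).mulVec x.ofLp
      = ∑ s, (signLaw X).real {s} * ‖maskedTranspose X s x‖ ^ 2 := by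
  simp only [meanGram_eq_sum, Matrix.sum_mulVec, dotProduct_sum, Matrix.smul_mulVec,
    dotProduct_smul, smul_eq_mul, norm_sq_maskedTranspose]

theorem posSemidef_meanGram (X : Matrix (Fin n) (Fin d) ℝ) : (meanGram X).PosSemidef := by
  refine Matrix.PosSemidef.of_dotProduct_mulVec_nonneg ?_ fun x => ?_
  · rw [Matrix.IsHermitian, Matrix.conjTranspose_eq_transpose_of_trivial, meanGram_eq_sum,
      Matrix.transpose_sum]
    refine Finset.sum_congr rfl fun s _ => ?_
    simp only [Matrix.transpose_smul, Matrix.transpose_mul, Matrix.transpose_transpose,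
      mask_transpose, Matrix.mul_assoc]
  · rw [star_trivial]
    have h := dotProduct_meanGram_mulVec X (WithLp.toLp 2 x)
    rw [h]
    exact Finset.sum_nonneg fun s _ => mul_nonneg measureReal_nonneg (sq_nonneg _)

theorem eigMin_meanGram_mul_le (X : Matrix (Fin n) (Fin d) ℝ) (x : EuclideanSpace ℝ (Fin n)) :
    eigMin (meanGram X) * ‖x‖ ^ 2
      ≤ ∑ s, (signLaw X).real {s} * ‖maskedTranspose X s x‖ ^ 2 := by
  rw [← dotProduct_meanGram_mulVec, norm_sq_eq_dotProduct]
  exact eigMin_mul_dotProduct_le (posSemidef_meanGram X).1 _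

theorem sum_signLaw_real (X : Matrix (Fin n) (Fin d) ℝ) : ∑ s, (signLaw X).real {s} = 1 := by
  have h := sum_measureReal_singleton (μ := signLaw X) Finset.univ
  rw [h]
  simp

/-- At a unit vector, the mean of `‖(D X)ᵀ e‖²` lies between the two eigenvalues. -/
theorem eigMin_meanGram_le_eigMax (hn : 0 < n) (X : Matrix (Fin n) (Fin d) ℝ) :
    eigMin (meanGram X) ≤ eigMax (X * X.transpose) := by
  let e : EuclideanSpace ℝ (Fin n) := EuclideanSpace.single ⟨0, hn⟩ 1
  have he : ‖e‖ = 1 := by simp [e]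
  have h1 := eigMin_meanGram_mul_le X e
  have h2 : ∑ s, (signLaw X).real {s} * ‖maskedTranspose X s e‖ ^ 2
      ≤ ∑ s, (signLaw X).real {s} * eigMax (X * X.transpose) :=
    Finset.sum_le_sum fun s _ => mul_le_mul_of_nonneg_left
      (by simpa [he] using norm_sq_maskedTranspose_le X s e) measureReal_nonneg
  rw [← Finset.sum_mul, sum_signLaw_real, one_mul] at h2
  rw [he] at h1
  linarith

/-! ### Surjectivity of the output map -/

/-- If the maps `(D_i X)ᵀ` have trivial common kernel, then `∑ D_i X Xᵀ D_i` is positive definite,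
and `u_i = (D_i X)ᵀ z`, with `z` its inverse applied to `y`, has output `y`. -/
theorem exists_output_eq {P : ℕ} (X : Matrix (Fin n) (Fin d) ℝ) (t : Fin P → Fin n → Bool)
    (ht : (⨅ i, LinearMap.ker (maskedTranspose X (t i))) = ⊥) (y : EuclideanSpace ℝ (Fin n)) :
    ∃ u : Fin P → EuclideanSpace ℝ (Fin d), output X (fun i => mask (t i)) u = y := by
  let A : Matrix (Fin n) (Fin n) ℝ := ∑ i, mask (t i) * (X * X.transpose) * mask (t i)
  have hA : Function.Injective (Matrix.toEuclideanLin A) := by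
    refine (injective_iff_map_eq_zero _).2 fun x hx => ?_
    have h0 : ∑ i, ‖maskedTranspose X (t i) x‖ ^ 2 = 0 := by
      simp only [norm_sq_maskedTranspose]
      rw [← dotProduct_sum, ← Matrix.sum_mulVec, ← Matrix.toLin'_apply,
        ← Matrix.ofLp_toLpLin 2 2, hx]
      simp
    rw [Finset.sum_eq_zero_iff_of_nonneg fun i _ => sq_nonneg _] at h0
    rw [← Submodule.mem_bot ℝ, ← ht, Submodule.mem_iInf]
    intro i
    simpa using h0 i (Finset.mem_univ i)
  obtain ⟨z, hz⟩ := LinearMap.surjective_of_injective hA y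
  refine ⟨fun i => maskedTranspose X (t i) z, ?_⟩
  rw [← hz, output]
  change WithLp.toLp 2 _ = WithLp.toLp 2 (A.mulVec z.ofLp)
  rw [Matrix.sum_mulVec]
  congr 1
  refine Finset.sum_congr rfl fun i _ => ?_
  rw [maskedTranspose, Matrix.ofLp_toLpLin, Matrix.toLin'_apply, Matrix.mulVec_mulVec,
    Matrix.transpose_mul, mask_transpose]
  simp only [Matrix.mul_assoc]

theorem isLeast_range_objective_zero {P : ℕ} (X : Matrix (Fin n) (Fin d) ℝ)
    (D : Fin P → Matrix (Fin n) (Fin n) ℝ) (y : EuclideanSpace ℝ (Fin n))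
    (h : ∃ u, output X D u = y) : IsLeast (Set.range (objective X D y 0)) 0 := by
  obtain ⟨u, hu⟩ := h
  refine ⟨⟨u, by simp [objective, hu]⟩, ?_⟩
  rintro _ ⟨v, rfl⟩
  rw [objective, zero_mul, add_zero]
  positivity

/-! ### The probability of a bad draw -/

theorem measureReal_pi_signLaw {P : ℕ} (X : Matrix (Fin n) (Fin d) ℝ)
    (G : Finset (Fin P → Fin n → Bool)) :
    (Measure.pi fun _ : Fin P => signLaw X).real G = ∑ t ∈ G, ∏ i, (signLaw X).real {t i} := by
  rw [← sum_measureReal_singleton]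
  refine Finset.sum_congr rfl fun t _ => ?_
  rw [measureReal_def, Measure.pi_singleton, ENNReal.toReal_prod]
  rfl

end Patterns

end GatedReLU

open GatedReLU in
theorem proposition3p2 {n d : ℕ} (hn : 0 < n) (X : Matrix (Fin n) (Fin d) ℝ)
    (hM : IsUnit (GatedReLU.meanGram X)) (δ : ℝ) (hδ : 0 < δ)
    (P : ℕ) (hP : 2 * GatedReLU.kappa X * Real.log ((n : ℝ) / δ) ≤ (P : ℝ))
    {Ω : Type*} [MeasurableSpace Ω] (μ : Measure Ω) [IsProbabilityMeasure μ]
    (g : Fin P → Ω → EuclideanSpace ℝ (Fin d))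
    (hlaw : ∀ i, HasLaw (g i) (stdGaussian (EuclideanSpace ℝ (Fin d))) μ)
    (hindep : iIndepFun g μ) :
    1 - δ ≤ μ.real {ω | ∀ y : EuclideanSpace ℝ (Fin n),
      (∃ u : Fin P → EuclideanSpace ℝ (Fin d),
        GatedReLU.output X (fun i => GatedReLU.pattern X (g i ω)) u = y) ∧
      IsLeast (Set.range
        (GatedReLU.objective X (fun i => GatedReLU.pattern X (g i ω)) y 0)) 0} := by
  classical
  set R := eigMax (X * X.transpose) with hRdef
  set m := eigMin (meanGram X) with hmdef
  have hm : 0 < m := eigMin_pos hn (posSemidef_meanGram X) hM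
  have hmR : m ≤ R := eigMin_meanGram_le_eigMax hn X
  have hR : 0 < R := hm.trans_le hmR
  let T : Ω → Fin P → Fin n → Bool := fun ω i => signs X (g i ω)
  have hTi : ∀ i, AEMeasurable (fun ω => signs X (g i ω)) μ := fun i =>
    (measurable_signs X).comp_aemeasurable (hlaw i).aemeasurable
  have hT : AEMeasurable T μ := aemeasurable_pi_lambda _ hTi
  have hmap : μ.map T = Measure.pi fun _ => signLaw X := by
    have h := (iIndepFun_iff_map_fun_eq_pi_map hTi).1
      (hindep.comp (fun _ => signs X) fun _ => measurable_signs X)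
    rw [h]
    congr 1
    funext i
    rw [signLaw, ← (hlaw i).map_eq,
      AEMeasurable.map_map_of_aemeasurable (measurable_signs X).aemeasurable (hlaw i).aemeasurable]
    rfl
  let bad : Finset (Fin P → Fin n → Bool) :=
    {t | (⨅ i, LinearMap.ker (maskedTranspose X (t i))) ≠ ⊥}
  have hbad : μ.real (T ⁻¹' bad) ≤ δ := by
    have h1 : μ.real (T ⁻¹' bad) ≤ n * Real.exp (-(P * (m / R))) := by
      rw [← map_measureReal_apply_of_aemeasurable hT bad.measurableSet, hmap,
        measureReal_pi_signLaw]
      have h := sum_prod_le_of_iInf_ker_ne_bot (maskedTranspose X) (fun s => (signLaw X).real {s})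
        (fun _ => measureReal_nonneg) (sum_signLaw_real X) hR hmR
        (norm_sq_maskedTranspose_le X) (eigMin_meanGram_mul_le X) P bad
        (fun t ht => by simpa [bad] using ht)
      simpa using h
    have hn' : (0 : ℝ) < n := by exact_mod_cast hn
    rcases le_total (Real.log (n / δ)) 0 with hlog | hlog
    · -- Here `n ≤ δ`, so `δ` is at least one.
      have h2 : (n : ℝ) ≤ δ := by
        rw [Real.log_nonpos_iff (by positivity), div_le_one hδ] at hlog
        exact hlog
      have h3 : (1 : ℝ) ≤ n := by exact_mod_cast hn
      exact measureReal_le_one.trans (h3.trans h2)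
    · have h2 : Real.log (n / δ) ≤ P * (m / R) := by
        have h3 : R / m * Real.log (n / δ) ≤ P := by
          have h4 : 0 ≤ R / m * Real.log (n / δ) := by positivity
          rw [kappa, ← hRdef, ← hmdef] at hP
          linarith
        calc Real.log (n / δ) = R / m * Real.log (n / δ) * (m / R) := by field_simp
          _ ≤ _ := mul_le_mul_of_nonneg_right h3 (by positivity)
      calc μ.real (T ⁻¹' bad) ≤ _ := h1
        _ ≤ n * Real.exp (-Real.log (n / δ)) := by gcongr
        _ = δ := by
          rw [Real.exp_neg, Real.exp_log (by positivity)]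
          field_simp
  have hcompl : μ.real (T ⁻¹' bad)ᶜ = 1 - μ.real (T ⁻¹' bad) :=
    probReal_compl_eq_one_sub₀ (hT.nullMeasurableSet_preimage bad.measurableSet)
  refine le_trans (by linarith) (measureReal_mono (s₁ := (T ⁻¹' bad)ᶜ) ?_)
  intro ω hω y
  have hω' : (⨅ i, LinearMap.ker (maskedTranspose X (signs X (g i ω)))) = ⊥ := by
    simpa [bad, T] using hω
  have hex := exists_output_eq X (fun i => signs X (g i ω)) hω' y
  simp only [← pattern_eq_mask_signs] at hex
  exact ⟨hex, isLeast_range_objective_zero X _ y hex⟩
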